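/- Let $n\ge 2$, let $S\subset\mathbb R^{n+1}$ be a hypersurface with surface measure $\sigma$, and suppose that in an open set $U\ni y=(z,g(z))$ the set $S$ is exactly the graph $x_{n+1}=g(x_1,\dots,x_n)$, where $g$ is real-analytic on the projection of $U$ to $\mathbb R^n$. Let $T_y(S)=\{(v,\nabla g(z)\cdot v):v\in\mathbb R^n\}$ be the tangent space at $y$, regarded as a linear subspace of $\mathbb R^{n+1}$, and put $H(x)=g(x+z)-g(z)-\nabla g(z)\cdot x$. Let $\phi$ be a smooth real function with compact support in $U$ and $$Mf(x)=\sup_{t>0}\Big|\int_S f(x-ts)\,\phi(s)\,d\sigma(s)\Big|$$ for Schwartz functions $f$ on $\mathbb R^{n+1}$; $M$ is bounded on $L^p$ if there is a finite $C$ with $\|Mf\|_p\le C\|f\|_p$ for all such $f$, and unbounded on $L^p$ otherwise. Let $\sum_\alpha H_\alpha x^\alpha$ be the Taylor series of $H$ at $0$. The Newton polyhedron $N(H)$ is the convex hull of the octants $\{x: x_i\ge\alpha_i \text{ for all } i\}$ over all $\alpha$ with $H_\alpha\ne0$; the Newton distance is $d(H)=\inf\{t:(t,\dots,t)\in N(H)\}$;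 and for a (nonempty) compact face $F$ of $N(H)$, vertices included, $H_F(x)=\sum_{\alpha\in F}H_\alpha x^\alpha$. **Theorem 1.2.** Suppose that $y\notin T_y(S)$ and that $\phi\ge0$ on $S$ with $\phi(y)\ne0$. Let $m$ be the maximum order of any zero in $(\mathbb R\setminus\{0\})^n$ of any $H_F$, $F$ a compact face of $N(H)$, and suppose $m>\max(d(H),2)$. Suppose there is a sequence of points $a^k\in(\mathbb R\setminus\{0\})^n$ with $a^k\to0$ such that for every $k$ there are an index $i$ and real-analytic functions $\xi_k$ (near $a^k$) and $b_k$ (near $(a^k_j)_{j\ne i}$) with $\xi_k(a^k)\ne0$, $b_k((a^k_j)_{j\neq i})=a^k_i$, and $$H(x)=\xi_k(x)\,\big(x_i-b_k((x_j)_{j\ne i})\big)^m$$ on a neighborhood of $a^k$. Then $M$ is unbounded on $L^p$ for every $p$ with $0<p\le m$. -/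

import Mathlib

open MeasureTheory Filter Topology
open scoped ENNReal NNReal ContDiff SchwartzMap

noncomputable section

namespace NewtonMaximal

/-! ### Taylor coefficients, Newton polyhedron, face polynomials -/

/-- The partial derivative `∂f/∂xᵢ`. -/
def partialDeriv {n : ℕ} (i : Fin n) (f : EuclideanSpace ℝ (Fin n) → ℝ) :
    EuclideanSpace ℝ (Fin n) → ℝ :=
  fun x => fderiv ℝ f x (EuclideanSpace.single i 1)

/-- The mixed partial derivative `∂^α f = ∂₀^{α₀} ∂₁^{α₁} ⋯ f` for a multi-index `α`. -/
def mixedPartial {n : ℕ} (α : Fin n → ℕ) (f : EuclideanSpace ℝ (Fin n) → ℝ) :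
    EuclideanSpace ℝ (Fin n) → ℝ :=
  (List.finRange n).foldr (fun i h => (partialDeriv i)^[α i] h) f

/-- The coefficient `f_α = ∂^α f(0) / α!` of `x^α` in the Taylor expansion of `f` at the origin. -/
def taylorCoeff {n : ℕ} (f : EuclideanSpace ℝ (Fin n) → ℝ) (α : Fin n → ℕ) : ℝ :=
  mixedPartial α f 0 / ∏ i, ((α i).factorial : ℝ)

/-- The Newton polyhedron `N(f)`: the convex hull of the octants `{x : xᵢ ≥ αᵢ for all i}` over all
multi-indices `α` with `f_α ≠ 0`. -/
def newtonPolyhedron {n : ℕ} (f : EuclideanSpace ℝ (Fin n) → ℝ) : Set (Fin n → ℝ) :=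
  convexHull ℝ {x | ∃ α : Fin n → ℕ, taylorCoeff f α ≠ 0 ∧ ∀ i, (α i : ℝ) ≤ x i}

/-- The Newton distance `d(f) = inf {t : (t, …, t) ∈ N(f)}`. -/
def newtonDistance {n : ℕ} (f : EuclideanSpace ℝ (Fin n) → ℝ) : ℝ :=
  sInf {t : ℝ | (fun _ : Fin n => t) ∈ newtonPolyhedron f}

/-- `F` is a compact face of `N(f)`: a nonempty compact set of the form
`{x ∈ N(f) : l(x) = max over N(f) of l}` for a linear functional `l`. Vertices are included. -/
def IsCompactFace {n : ℕ} (f : EuclideanSpace ℝ (Fin n) → ℝ) (F : Set (Fin n → ℝ)) : Prop :=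
  F.Nonempty ∧ IsCompact F ∧ IsExposed ℝ (newtonPolyhedron f) F

/-- The face polynomial `f_F(x) = ∑_{α ∈ F} f_α x^α`; for compact `F` the sum is finite. -/
def facePoly {n : ℕ} (f : EuclideanSpace ℝ (Fin n) → ℝ) (F : Set (Fin n → ℝ)) :
    EuclideanSpace ℝ (Fin n) → ℝ :=
  fun x => ∑ᶠ (α : Fin n → ℕ) (_ : (fun i => (α i : ℝ)) ∈ F), taylorCoeff f α * ∏ i, x i ^ α i

/-- `h` has a zero of order exactly `k` at `w`: `h(w) = 0`, all derivatives of order less than `k`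
vanish at `w`, and some derivative of order `k` does not. -/
def HasZeroOfOrder {n : ℕ} (h : EuclideanSpace ℝ (Fin n) → ℝ) (w : EuclideanSpace ℝ (Fin n))
    (k : ℕ) : Prop :=
  h w = 0 ∧ (∀ j < k, iteratedFDeriv ℝ j h w = 0) ∧ iteratedFDeriv ℝ k h w ≠ 0

/-- The set of orders of the zeros in `(ℝ ∖ {0})ⁿ` of the face polynomials `f_F`, over all compact
faces `F` of `N(f)`. -/
def faceZeroOrders {n : ℕ} (f : EuclideanSpace ℝ (Fin n) → ℝ) : Set ℕ :=
  {k | ∃ F, IsCompactFace f F ∧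
    ∃ w : EuclideanSpace ℝ (Fin n), (∀ i, w i ≠ 0) ∧ HasZeroOfOrder (facePoly f F) w k}

/-! ### The hypersurface in graph coordinates -/

/-- The projection `(x₁, …, x_{n+1}) ↦ (x₁, …, xₙ)`. -/
def proj {n : ℕ} (q : EuclideanSpace ℝ (Fin (n + 1))) : EuclideanSpace ℝ (Fin n) :=
  WithLp.toLp 2 fun i => q i.castSucc

/-- The point `(x, g(x))` of the graph of `g`. -/
def graphPoint {n : ℕ} (g : EuclideanSpace ℝ (Fin n) → ℝ) (x : EuclideanSpace ℝ (Fin n)) :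
    EuclideanSpace ℝ (Fin (n + 1)) :=
  WithLp.toLp 2 (Fin.snoc (α := fun _ => ℝ) (fun i => x i) (g x))

/-- Inside `U`, the set `S` is exactly the graph of `g`. -/
def IsGraphOn {n : ℕ} (S U : Set (EuclideanSpace ℝ (Fin (n + 1))))
    (g : EuclideanSpace ℝ (Fin n) → ℝ) : Prop :=
  ∀ q ∈ U, q ∈ S ↔ q (Fin.last n) = g (proj q)

/-- The tangent space at `(z, g(z))` of the graph of `g`, as a linear subspace of `ℝ^{n+1}` (a
hyperplane through the origin): the vectors `(v, ∇g(z)·v)`. -/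
def tangentSpace {n : ℕ} (g : EuclideanSpace ℝ (Fin n) → ℝ) (z : EuclideanSpace ℝ (Fin n)) :
    Set (EuclideanSpace ℝ (Fin (n + 1))) :=
  {q | q (Fin.last n) = fderiv ℝ g z (proj q)}

/-- `H(x) = g(x + z) - g(z) - ∇g(z)·x`. -/
def heightFn {n : ℕ} (g : EuclideanSpace ℝ (Fin n) → ℝ) (z : EuclideanSpace ℝ (Fin n)) :
    EuclideanSpace ℝ (Fin n) → ℝ :=
  fun x => g (x + z) - g z - fderiv ℝ g z x

/-! ### The maximal operator -/

/-- `Mf(x) = sup_{t > 0} |∫_S f(x - ts) φ(s) dσ(s)|`, where `σ` is the surface measure on `S`, that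
is, `n`-dimensional Hausdorff measure with Euclidean normalization. -/
def maximalFn {n : ℕ} (S : Set (EuclideanSpace ℝ (Fin (n + 1))))
    (φ : EuclideanSpace ℝ (Fin (n + 1)) → ℝ) (f : EuclideanSpace ℝ (Fin (n + 1)) → ℂ)
    (x : EuclideanSpace ℝ (Fin (n + 1))) : ℝ≥0∞ :=
  ⨆ (t : ℝ) (_ : 0 < t), ‖∫ s in S, φ s • f (x - t • s) ∂(μHE[n])‖ₑ

/-- `M` is bounded on `L^p`: `‖Mf‖_p ≤ C ‖f‖_p` for all Schwartz functions `f`, with `C` finite and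
independent of `f`. -/
def MaximalBoundedOnLp {n : ℕ} (S : Set (EuclideanSpace ℝ (Fin (n + 1))))
    (φ : EuclideanSpace ℝ (Fin (n + 1)) → ℝ) (p : ℝ) : Prop :=
  ∃ C : ℝ≥0, ∀ f : 𝓢(EuclideanSpace ℝ (Fin (n + 1)), ℂ),
    eLpNorm (maximalFn S φ f) (ENNReal.ofReal p) volume
      ≤ C * eLpNorm f (ENNReal.ofReal p) volume

end NewtonMaximal

end

/-!
Let `P` be the affine tangent hyperplane of `S` at `y`. It is the level set `ℓ = ℓ(y)` of
`ℓ = tangentFunctional g z`, and the hypothesis `y ∉ T_y(S)` says that `ℓ(y) ≠ 0`, so `P` misses the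
origin. On the graph, `ℓ - ℓ(y)` is the function `H`. For a point `x` with `ℓ(x) / ℓ(y)` positive,
the dilation `t = ℓ(x) / ℓ(y)` gives `ℓ(x - ts) = -t H` at the point `s` of the surface. Hence, if
`f` behaves like `|ℓ|^{-1/m}` near the hyperplane `ℓ = 0`, the average `∫ f(x - ts) φ(s) dσ(s)` is
comparable to `∫ |H|^{-1/m} φ dσ`. Near a point `a^k` at which `φ` is still positive, `H` is
`O(|xᵢ - b|^m)`, so this integral diverges logarithmically, and it does so for a set of `x` of
positive measure.

Schwartz functions are obtained by truncating to `N` dyadic scales (`slabSum`):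
`f = χ ∑_{j < N} 2^j β(2^{jm} ℓ)`. Each scale contributes `O(1)` to `∫ |f|^m`
(`exists_lintegral_slabSum_le`), so by Hölder's inequality `‖f‖_p = O(N^{1/m})` for every `p ≤ m`,
including `p < 1` (`exists_eLpNorm_slabSum_le`). Each scale also contributes a fixed positive amount
to the averages, because the part of the surface with `|H| ≤ 2^{-jm} / 2` has measure at least a
multiple of `2^{-j}` (`exists_le_restrict_near_tangent`); so `Mf` is at least a multiple of `N` on a
fixed open set (`ofReal_mul_le_enorm_integral_slabSum`). As `m ≥ 2`, a bound `N ≲ N^{1/m}` is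
impossible for large `N` (`not_forall_eLpNorm_iSup_le`).

The two volume estimates, from above for slabs and from below for neighbourhoods of graphs, come
from packing and covering by translates. The surface measure is compared with Lebesgue measure
through the Lipschitz maps `graphPoint g` and `proj`; local finiteness of the surface measure is
what makes the averages honest integrals.
-/

/-! ### Volume of neighbourhoods of hyperplanes and graphs -/

/-- The part of a slab `|ℓ| ≤ ε` inside a ball has volume `O(ε)`: about `1 / (3ε)` disjoint
translates of it fit into a larger ball. -/
theorem exists_measure_closedBall_inter_slab_le {E : Type*} [NormedAddCommGroup E]
    [NormedSpace ℝ E] [FiniteDimensional ℝ E] [MeasurableSpace E] [BorelSpace E] (μ : Measure E)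
    [μ.IsAddHaarMeasure] {ℓ : E →L[ℝ] ℝ} (hℓ : ℓ ≠ 0) (R : ℝ) :
    ∃ C : ℝ≥0∞, C ≠ ⊤ ∧ ∀ ε : ℝ, 0 < ε →
      μ (Metric.closedBall 0 R ∩ {x | |ℓ x| ≤ ε}) ≤ C * ENNReal.ofReal ε := by
  obtain ⟨v₀, hv₀⟩ : ∃ v, ℓ v ≠ 0 := by
    by_contra! h
    exact hℓ (ContinuousLinearMap.ext h)
  obtain ⟨v, hv⟩ : ∃ v, ℓ v = 1 := ⟨(ℓ v₀)⁻¹ • v₀, by simp [hv₀]⟩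
  refine ⟨μ (Metric.closedBall 0 (R + ‖v‖)) * 3,
    ENNReal.mul_ne_top measure_closedBall_lt_top.ne (by simp), fun ε hε => ?_⟩
  set A : Set E := Metric.closedBall 0 R ∩ {x | |ℓ x| ≤ ε} with hA
  have hAm : MeasurableSet A := (Metric.isClosed_closedBall.inter
    (isClosed_le ℓ.continuous.abs continuous_const)).measurableSet
  -- translates by steps of `3ε` along `v` are disjoint, the slab having `ℓ`-width `2ε`
  set N : ℕ := ⌊1 / (3 * ε)⌋₊ + 1 with hN
  set T : ℕ → Set E := fun k => (fun x => x + (-(3 * ε * k)) • v) ⁻¹' A with hT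
  have hTm : ∀ k, MeasurableSet (T k) := fun k => (measurable_add_const _) hAm
  have hTμ : ∀ k, μ (T k) = μ A := fun k => measure_preimage_add_right μ _ A
  have hdisj : ((Finset.range N : Finset ℕ) : Set ℕ).PairwiseDisjoint T := by
    intro j _ k _ hjk
    refine Set.disjoint_left.2 fun x hxj hxk => ?_
    have h1 : |ℓ x - 3 * ε * j| ≤ ε := by
      have := hxj.2
      simpa [hv, sub_eq_add_neg] using this
    have h2 : |ℓ x - 3 * ε * k| ≤ ε := by
      have := hxk.2
      simpa [hv, sub_eq_add_neg] using this
    rw [abs_le] at h1 h2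
    rcases Nat.lt_or_gt_of_ne hjk with h | h
    · have : (j : ℝ) + 1 ≤ k := by exact_mod_cast h
      nlinarith
    · have : (k : ℝ) + 1 ≤ j := by exact_mod_cast h
      nlinarith
  have hsub : (⋃ k ∈ Finset.range N, T k) ⊆ Metric.closedBall 0 (R + ‖v‖) := by
    refine Set.iUnion₂_subset fun k hk x hx => ?_
    have hk' : (k : ℝ) ≤ 1 / (3 * ε) := by
      have h1 : k ≤ ⌊1 / (3 * ε)⌋₊ := by
        have := Finset.mem_range.1 hk
        omega
      exact (Nat.le_floor_iff (by positivity)).1 h1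
    have hk1 : 3 * ε * k ≤ 1 := by
      rw [le_div_iff₀ (by positivity)] at hk'
      linarith
    have h1 : ‖x + (-(3 * ε * k)) • v‖ ≤ R := by simpa using hx.1
    have h2 : ‖(3 * ε * k) • v‖ ≤ ‖v‖ := by
      rw [norm_smul, Real.norm_of_nonneg (by positivity)]
      exact mul_le_of_le_one_left (norm_nonneg _) hk1
    rw [mem_closedBall_zero_iff]
    calc ‖x‖ = ‖(x + (-(3 * ε * k)) • v) + (3 * ε * k) • v‖ := by
          congr 1
          rw [neg_smul]
          abel
      _ ≤ R + ‖v‖ := (norm_add_le _ _).trans (add_le_add h1 h2)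
  have hle : (N : ℝ≥0∞) * μ A ≤ μ (Metric.closedBall 0 (R + ‖v‖)) := by
    refine le_trans (le_of_eq ?_) (measure_mono hsub)
    rw [measure_biUnion_finset hdisj fun k _ => hTm k]
    simp [hTμ]
  have hone : (1 : ℝ≥0∞) ≤ 3 * ENNReal.ofReal ε * N := by
    have h1 : (1 : ℝ) ≤ 3 * ε * N := by
      have := (Nat.lt_floor_add_one (1 / (3 * ε))).le
      rw [div_le_iff₀ (by positivity)] at this
      rw [hN]
      push_cast
      linarith
    calc (1 : ℝ≥0∞) = ENNReal.ofReal 1 := by simp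
      _ ≤ ENNReal.ofReal (3 * ε * N) := ENNReal.ofReal_le_ofReal h1
      _ = 3 * ENNReal.ofReal ε * N := by
        rw [ENNReal.ofReal_mul (by positivity), ENNReal.ofReal_mul (by positivity)]
        simp
  calc μ A = 1 * μ A := (one_mul _).symm
    _ ≤ 3 * ENNReal.ofReal ε * N * μ A := by gcongr
    _ = 3 * ENNReal.ofReal ε * (N * μ A) := by ring
    _ ≤ 3 * ENNReal.ofReal ε * μ (Metric.closedBall 0 (R + ‖v‖)) := by gcongr
    _ = _ := by ring

/-- The `ε`-neighbourhood, in the direction `xᵢ`, of a graph `xᵢ = b((xⱼ)_{j ≠ i})` has volume at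
least a multiple of `ε`: a small ball is covered by `O(1 / ε)` translates of it. -/
theorem exists_le_volume_near_graph {n : ℕ} {i : Fin n}
    {b : EuclideanSpace ℝ {j : Fin n // j ≠ i} → ℝ} {a : EuclideanSpace ℝ (Fin n)}
    (hb : ContinuousAt b (WithLp.toLp 2 fun j => a j))
    (hba : b (WithLp.toLp 2 fun j => a j) = a i)
    {V : Set (EuclideanSpace ℝ (Fin n))} (hV : V ∈ 𝓝 a) :
    ∃ c > 0, ∃ ε₀ > 0, ∀ ε : ℝ, 0 < ε → ε ≤ ε₀ →
      ENNReal.ofReal (c * ε)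
        ≤ volume (V ∩ {x | |x i - b (WithLp.toLp 2 fun j => x j)| ≤ ε}) := by
  obtain ⟨r, hr, hrV⟩ := Metric.mem_nhds_iff.1 hV
  have hcont : ContinuousAt (fun x : EuclideanSpace ℝ (Fin n) =>
      x i - b (WithLp.toLp 2 fun j : {j : Fin n // j ≠ i} => x j)) a := by
    refine ContinuousAt.sub (by fun_prop) ?_
    exact ContinuousAt.comp (f := fun x : EuclideanSpace ℝ (Fin n) =>
      (WithLp.toLp 2 fun j : {j : Fin n // j ≠ i} => x j)) hb (by fun_prop)
  obtain ⟨ρ, hρ, hρr⟩ := Metric.mem_nhds_iff.1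
    (hcont.eventually (Metric.ball_mem_nhds _ (show 0 < r / 4 by positivity)))
  set ρ' := min ρ (r / 4) with hρ'
  have hρ'0 : 0 < ρ' := lt_min hρ (by positivity)
  set B : Set (EuclideanSpace ℝ (Fin n)) := Metric.ball a ρ' with hB
  have hBpos : 0 < (volume B).toReal := ENNReal.toReal_pos
    (Metric.measure_ball_pos volume a hρ'0).ne' measure_ball_lt_top.ne
  refine ⟨(volume B).toReal / (2 * r), by positivity, r / 4, by positivity, fun ε hε hεr => ?_⟩
  set D : Set (EuclideanSpace ℝ (Fin n)) :=
    V ∩ {x | |x i - b (WithLp.toLp 2 fun j => x j)| ≤ ε} with hD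
  set K : ℕ := ⌈r / (4 * ε)⌉₊ with hK
  -- moving `x` by a multiple of `ε` along the `i`-th axis leaves `b((xⱼ)_{j ≠ i})` unchanged and
  -- brings `xᵢ - b` into `[-ε, ε]`
  have hcov : B ⊆ ⋃ k ∈ Finset.Icc (-(K : ℤ)) K,
      (fun x => x + (-(k * ε)) • EuclideanSpace.single i (1 : ℝ)) ⁻¹' D := by
    intro x hx
    set s := x i - b (WithLp.toLp 2 fun j => x j) with hs
    have hsr : |s| < r / 4 := by
      have : x ∈ Metric.ball a ρ := Metric.ball_subset_ball (min_le_left _ _) hx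
      have := hρr this
      simpa [hba, Real.dist_eq] using this
    have hround := abs_sub_round (s / ε)
    have hmul : |s - round (s / ε) * ε| ≤ ε / 2 := by
      have : s - round (s / ε) * ε = (s / ε - round (s / ε)) * ε := by field_simp
      rw [this, abs_mul, abs_of_pos hε]
      nlinarith
    have hKr : r / 4 ≤ K * ε := by
      have := Nat.le_ceil (r / (4 * ε))
      rw [div_le_iff₀ (by positivity)] at this
      linarith
    rw [abs_le] at hmul
    rw [abs_lt] at hsr
    have hk1 : round (s / ε) ≤ K := by
      have : (round (s / ε) : ℝ) < K + 1 := by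
        by_contra! h
        nlinarith
      have : round (s / ε) < (K : ℤ) + 1 := by exact_mod_cast this
      omega
    have hk2 : -(K : ℤ) ≤ round (s / ε) := by
      have : (-K - 1 : ℝ) < round (s / ε) := by
        by_contra! h
        nlinarith
      have : -(K : ℤ) - 1 < round (s / ε) := by exact_mod_cast this
      omega
    refine Set.mem_iUnion₂.2 ⟨round (s / ε), Finset.mem_Icc.2 ⟨hk2, hk1⟩, ?_, ?_⟩
    · apply hrV
      rw [Metric.mem_ball, dist_eq_norm]
      have h1 : ‖x - a‖ < r / 4 := by
        rw [← dist_eq_norm]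
        exact lt_of_lt_of_le hx (min_le_right _ _)
      have h2 : ‖(-(round (s / ε) * ε)) • EuclideanSpace.single i (1 : ℝ)‖ ≤ r / 2 := by
        rw [norm_smul, PiLp.norm_single, norm_one, mul_one, norm_neg, Real.norm_eq_abs,
          abs_le]
        constructor <;> linarith
      calc ‖x + (-(round (s / ε) * ε)) • EuclideanSpace.single i (1 : ℝ) - a‖
          = ‖(x - a) + (-(round (s / ε) * ε)) • EuclideanSpace.single i (1 : ℝ)‖ := by
            congr 1
            abel
        _ ≤ _ := norm_add_le _ _
        _ < r := by linarith
    · have hb' : (WithLp.toLp 2 fun j : {j : Fin n // j ≠ i} =>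
          (x + (-(round (s / ε) * ε)) • EuclideanSpace.single i (1 : ℝ)) j)
          = (WithLp.toLp 2 fun j : {j : Fin n // j ≠ i} => x j) := by
        ext j
        simp [j.2]
      simp only [Set.mem_ofPred_eq]
      rw [hb']
      have : (x + (-(round (s / ε) * ε)) • EuclideanSpace.single i (1 : ℝ)) i
          - b (WithLp.toLp 2 fun j : {j : Fin n // j ≠ i} => x j) = s - round (s / ε) * ε := by
        simp [hs]
        ring
      rw [this, abs_le]
      constructor <;> linarith
  have hle : volume B ≤ (2 * K + 1 : ℕ) * volume D := by
    calc volume B ≤ _ := measure_mono hcov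
      _ ≤ _ := measure_biUnion_finset_le _ _
      _ = (2 * K + 1 : ℕ) * volume D := by
        simp_rw [measure_preimage_add_right]
        rw [Finset.sum_const, Int.card_Icc, nsmul_eq_mul]
        congr 2
        omega
  have hKε : (2 * K + 1 : ℝ) * ε ≤ 2 * r := by
    have := Nat.ceil_lt_add_one (show 0 ≤ r / (4 * ε) by positivity)
    have h2 : (K : ℝ) * ε < r / 4 + ε := by
      have h3 : (K : ℝ) * ε < (r / (4 * ε) + 1) * ε := by gcongr
      have h4 : (r / (4 * ε) + 1) * ε = r / 4 + ε := by field_simp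
      linarith
    linarith
  by_cases hDtop : volume D = ⊤
  · simp [hDtop]
  refine ENNReal.ofReal_le_of_le_toReal ?_
  have hle' : (volume B).toReal ≤ (2 * K + 1) * (volume D).toReal := by
    have := ENNReal.toReal_mono (ENNReal.mul_ne_top (ENNReal.natCast_ne_top _) hDtop) hle
    rw [ENNReal.toReal_mul, ENNReal.toReal_natCast] at this
    exact_mod_cast this
  rw [div_mul_eq_mul_div, div_le_iff₀ (by positivity)]
  calc (volume B).toReal * ε ≤ (2 * K + 1) * (volume D).toReal * ε := by gcongr
    _ = (volume D).toReal * ((2 * K + 1) * ε) := by ring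
    _ ≤ _ := by gcongr

namespace NewtonMaximal

/-! ### Surface measure of a graph -/

theorem lipschitzWith_proj {n : ℕ} : LipschitzWith 1 (proj (n := n)) := by
  refine LipschitzWith.of_dist_le_mul fun p q => ?_
  rw [NNReal.coe_one, one_mul, EuclideanSpace.dist_eq, EuclideanSpace.dist_eq]
  refine Real.sqrt_le_sqrt ?_
  rw [Fin.sum_univ_castSucc]
  simp only [proj]
  exact le_add_of_nonneg_right (sq_nonneg _)

theorem proj_graphPoint {n : ℕ} (g : EuclideanSpace ℝ (Fin n) → ℝ)
    (x : EuclideanSpace ℝ (Fin n)) : proj (graphPoint g x) = x := by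
  ext i
  simp [proj, graphPoint]

theorem graphPoint_last {n : ℕ} (g : EuclideanSpace ℝ (Fin n) → ℝ)
    (x : EuclideanSpace ℝ (Fin n)) : graphPoint g x (Fin.last n) = g x := by
  simp [graphPoint]

theorem graphPoint_proj {n : ℕ} {g : EuclideanSpace ℝ (Fin n) → ℝ}
    {q : EuclideanSpace ℝ (Fin (n + 1))} (hq : q (Fin.last n) = g (proj q)) :
    graphPoint g (proj q) = q := by
  ext i
  refine Fin.lastCases ?_ (fun j => ?_) i
  · rw [graphPoint_last, hq]
  · simp [proj, graphPoint]

theorem continuousAt_graphPoint {n : ℕ} {g : EuclideanSpace ℝ (Fin n) → ℝ}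
    {x : EuclideanSpace ℝ (Fin n)} (hg : ContinuousAt g x) : ContinuousAt (graphPoint g) x := by
  refine (PiLp.continuous_toLp 2 _).continuousAt.comp ?_
  refine continuousAt_pi.2 fun i => ?_
  refine Fin.lastCases ?_ (fun j => ?_) i
  · simpa using hg
  · simp only [Fin.snoc_castSucc]
    fun_prop

/-- The projection of a graph does not increase measure, being `1`-Lipschitz. -/
theorem volume_le_euclideanHausdorffMeasure_graphPoint {n : ℕ}
    (g : EuclideanSpace ℝ (Fin n) → ℝ) (A : Set (EuclideanSpace ℝ (Fin n))) :
    volume A ≤ μHE[n] (graphPoint g '' A) := by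
  have himg : proj '' (graphPoint g '' A) = A := by
    simp [Set.image_image, proj_graphPoint]
  rw [← EuclideanSpace.euclideanHausdorffMeasure_eq_volume]
  simp only [Measure.euclideanHausdorffMeasure_def, Measure.smul_apply]
  gcongr
  conv_lhs => rw [← himg]
  simpa using lipschitzWith_proj.hausdorffMeasure_image_le (Nat.cast_nonneg n) (graphPoint g '' A)

theorem lipschitzOnWith_graphPoint {n : ℕ} {g : EuclideanSpace ℝ (Fin n) → ℝ} {K : ℝ≥0}
    {W : Set (EuclideanSpace ℝ (Fin n))} (hg : LipschitzOnWith K g W) :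
    LipschitzOnWith (1 + K) (graphPoint g) W := by
  refine LipschitzOnWith.of_dist_le_mul fun x hx y hy => ?_
  have h := hg.dist_le_mul x hx y hy
  rw [EuclideanSpace.dist_eq, Fin.sum_univ_castSucc]
  simp only [graphPoint, Fin.snoc_castSucc, Fin.snoc_last]
  rw [← Real.sqrt_sq (dist_nonneg (x := x) (y := y)), EuclideanSpace.dist_eq] at h ⊢
  rw [Real.sq_sqrt (by positivity)] at h ⊢
  set Q := ∑ i, dist (x i) (y i) ^ 2 with hQ
  have hQ0 : 0 ≤ Q := by positivity
  rw [NNReal.coe_add, NNReal.coe_one]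
  refine Real.sqrt_le_iff.2 ⟨by positivity, ?_⟩
  have h2 : dist (g x) (g y) ^ 2 ≤ (K * √Q) ^ 2 := by gcongr
  have h3 := Real.sq_sqrt hQ0
  have h4 : 0 ≤ (K : ℝ) * Q := by positivity
  nlinarith

/-- Compact subsets of `U` meet `S` in a set of finite surface measure. -/
theorem euclideanHausdorffMeasure_restrict_lt_top {n : ℕ}
    {S U : Set (EuclideanSpace ℝ (Fin (n + 1)))} {g : EuclideanSpace ℝ (Fin n) → ℝ}
    (hU : IsOpen U) (hS : IsGraphOn S U g) (hg : AnalyticOnNhd ℝ g (proj '' U))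
    {K : Set (EuclideanSpace ℝ (Fin (n + 1)))} (hK : IsCompact K) (hKU : K ⊆ U) :
    (μHE[n] : Measure (EuclideanSpace ℝ (Fin (n + 1)))).restrict S K < ⊤ := by
  refine hK.measure_lt_top_of_nhdsWithin fun q hq => ?_
  have hqU := hKU hq
  obtain ⟨L, W, hW, hL⟩ :=
    ((hg _ ⟨q, hqU, rfl⟩).contDiffAt (n := 1)).exists_lipschitzOnWith
  obtain ⟨r, hr, hrW⟩ := Metric.mem_nhds_iff.1 hW
  set W' := Metric.ball (proj q) r with hW'
  have hopen : IsOpen (U ∩ proj ⁻¹' W') :=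
    hU.inter (Metric.isOpen_ball.preimage lipschitzWith_proj.continuous)
  refine ⟨U ∩ proj ⁻¹' W', mem_nhdsWithin_of_mem_nhds
    (hopen.mem_nhds ⟨hqU, Metric.mem_ball_self hr⟩), ?_⟩
  rw [Measure.restrict_apply hopen.measurableSet]
  have hsub : U ∩ proj ⁻¹' W' ∩ S ⊆ graphPoint g '' W' := fun p hp =>
    ⟨proj p, hp.1.2, graphPoint_proj ((hS p hp.1.1).1 hp.2)⟩
  refine (measure_mono hsub).trans_lt ?_
  have hfin : (μHE[n] : Measure (EuclideanSpace ℝ (Fin n))) W' < ⊤ := by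
    rw [EuclideanSpace.euclideanHausdorffMeasure_eq_volume]
    exact measure_ball_lt_top
  have hle : μHE[n] (graphPoint g '' W')
      ≤ ((1 + L : ℝ≥0) : ℝ≥0∞) ^ (n : ℝ) * μHE[n] W' := by
    simp only [Measure.euclideanHausdorffMeasure_def, Measure.smul_apply]
    rw [mul_smul_comm]
    gcongr
    exact (lipschitzOnWith_graphPoint (hL.mono hrW)).hausdorffMeasure_image_le (Nat.cast_nonneg n)
  refine hle.trans_lt (ENNReal.mul_lt_top ?_ hfin)
  exact ENNReal.rpow_lt_top_of_nonneg (Nat.cast_nonneg n) ENNReal.coe_ne_top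

/-! ### Test functions concentrated along a hyperplane -/

/-- A smooth cutoff of the interval `[-1, 1]`, vanishing off `[-2, 2]`. -/
noncomputable def unitBump : ContDiffBump (0 : ℝ) := ⟨1, 2, one_pos, one_lt_two⟩

/-- The sum `χ(x) ∑_{j < N} 2^j β(2^{jm} ℓ(x))`, with `β` a bump: a smooth compactly supported
truncation of `|ℓ|^{-1/m}`, resolved down to the scale `|ℓ| ≈ 2^{-Nm}`. -/
noncomputable def slabSum {E : Type*} [NormedAddCommGroup E] [NormedSpace ℝ E]
    (ℓ : E →L[ℝ] ℝ) (χ : E → ℝ) (m N : ℕ) (x : E) : ℝ :=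
  χ x * ∑ j ∈ Finset.range N, 2 ^ j * unitBump (2 ^ (j * m) * ℓ x)

theorem sum_two_pow_pow_le {m : ℕ} (hm : m ≠ 0) (A : Finset ℕ) :
    (∑ j ∈ A, (2 : ℝ≥0∞) ^ j) ^ m ≤ ∑ j ∈ A, 2 ^ m * 2 ^ (j * m) := by
  rcases A.eq_empty_or_nonempty with rfl | hA
  · simp [hm]
  -- the largest term dominates the geometric sum up to a factor `2`
  have h : (∑ j ∈ A, (2 : ℝ≥0∞) ^ j) ≤ 2 ^ (A.max' hA + 1) := by
    have := (Nat.geomSum_lt (le_refl 2) (s := A) (n := A.max' hA + 1)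
      fun k hk => Nat.lt_succ_of_le (A.le_max' k hk)).le
    exact_mod_cast this
  calc (∑ j ∈ A, (2 : ℝ≥0∞) ^ j) ^ m ≤ (2 ^ (A.max' hA + 1)) ^ m := by gcongr
    _ = 2 ^ m * 2 ^ (A.max' hA * m) := by rw [← pow_mul, ← pow_add]; congr 1; ring
    _ ≤ _ := Finset.single_le_sum (f := fun j => (2 : ℝ≥0∞) ^ m * 2 ^ (j * m))
      (fun _ _ => zero_le) (A.max'_mem hA)

section slabSum

variable {E : Type*} [NormedAddCommGroup E] [NormedSpace ℝ E] {ℓ : E →L[ℝ] ℝ} {χ : E → ℝ}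
  {m N : ℕ}

theorem slabSum_nonneg (hχ : ∀ x, 0 ≤ χ x) (x : E) : 0 ≤ slabSum ℓ χ m N x :=
  mul_nonneg (hχ x) (Finset.sum_nonneg fun _ _ => mul_nonneg (by positivity) unitBump.nonneg)

theorem contDiff_slabSum (hχ : ContDiff ℝ ∞ χ) : ContDiff ℝ ∞ (slabSum ℓ χ m N) := by
  refine hχ.mul (ContDiff.sum fun j _ => contDiff_const.mul ?_)
  exact unitBump.contDiff.comp (contDiff_const.mul ℓ.contDiff)

theorem hasCompactSupport_slabSum (hχ : HasCompactSupport χ) :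
    HasCompactSupport (slabSum ℓ χ m N) :=
  hχ.mul_right

theorem enorm_slabSum_pow_le {R : ℝ} (hχ0 : ∀ x, 0 ≤ χ x) (hχ1 : ∀ x, χ x ≤ 1)
    (hχR : ∀ x, x ∉ Metric.closedBall 0 R → χ x = 0) (hm : m ≠ 0) (x : E) :
    ‖slabSum ℓ χ m N x‖ₑ ^ m ≤ ∑ j ∈ Finset.range N,
      (Metric.closedBall 0 R ∩ {x | |ℓ x| ≤ 2 * (2 ^ (j * m))⁻¹}).indicator
        (fun _ => (2 : ℝ≥0∞) ^ m * 2 ^ (j * m)) x := by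
  classical
  by_cases hx : x ∈ Metric.closedBall 0 R
  swap
  · simp [slabSum, hχR x hx, hm]
  set A := (Finset.range N).filter fun j => |ℓ x| ≤ 2 * (2 ^ (j * m))⁻¹ with hA
  have h1 : slabSum ℓ χ m N x ≤ ∑ j ∈ A, (2 : ℝ) ^ j := by
    have h0 : 0 ≤ ∑ j ∈ Finset.range N, 2 ^ j * unitBump (2 ^ (j * m) * ℓ x) :=
      Finset.sum_nonneg fun _ _ => mul_nonneg (by positivity) unitBump.nonneg
    refine (mul_le_of_le_one_left h0 (hχ1 x)).trans ?_
    rw [hA, Finset.sum_filter]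
    refine Finset.sum_le_sum fun j _ => ?_
    split_ifs with hj
    · exact mul_le_of_le_one_right (by positivity) unitBump.le_one
    · rw [unitBump.zero_of_le_dist, mul_zero]
      rw [not_le, ← div_eq_mul_inv, div_lt_iff₀ (by positivity)] at hj
      rw [Real.dist_eq, sub_zero, abs_mul, abs_of_pos (by positivity : (0 : ℝ) < 2 ^ (j * m)),
        mul_comm]
      exact hj.le
  have h2 : ‖slabSum ℓ χ m N x‖ₑ ≤ ∑ j ∈ A, (2 : ℝ≥0∞) ^ j := by
    rw [Real.enorm_of_nonneg (slabSum_nonneg hχ0 x)]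
    refine (ENNReal.ofReal_le_ofReal h1).trans (le_of_eq ?_)
    rw [ENNReal.ofReal_sum_of_nonneg fun _ _ => by positivity]
    refine Finset.sum_congr rfl fun j _ => ?_
    rw [ENNReal.ofReal_pow (by norm_num)]
    simp
  calc ‖slabSum ℓ χ m N x‖ₑ ^ m ≤ (∑ j ∈ A, (2 : ℝ≥0∞) ^ j) ^ m := by gcongr
    _ ≤ ∑ j ∈ A, 2 ^ m * 2 ^ (j * m) := sum_two_pow_pow_le hm A
    _ = _ := by
      rw [hA, Finset.sum_filter]
      refine Finset.sum_congr rfl fun j _ => ?_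
      simp only [Set.indicator, Set.mem_inter_iff, Set.mem_ofPred_eq, hx, true_and]

/-- `slabSum` has `L^m` norm `O(N^{1/m})`, each scale contributing `O(1)` to the `m`-th power. -/
theorem exists_lintegral_slabSum_le [FiniteDimensional ℝ E] [MeasurableSpace E] [BorelSpace E]
    (μ : Measure E) [μ.IsAddHaarMeasure] (hℓ : ℓ ≠ 0) {R : ℝ} (hχ0 : ∀ x, 0 ≤ χ x)
    (hχ1 : ∀ x, χ x ≤ 1) (hχR : ∀ x, x ∉ Metric.closedBall 0 R → χ x = 0) (hm : m ≠ 0) :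
    ∃ C : ℝ≥0∞, C ≠ ⊤ ∧ ∀ N, ∫⁻ x, ‖slabSum ℓ χ m N x‖ₑ ^ m ∂μ ≤ C * N := by
  obtain ⟨C, hC, hle⟩ := exists_measure_closedBall_inter_slab_le μ hℓ R
  refine ⟨2 ^ m * C * 2, by finiteness, fun N => ?_⟩
  have hmeas : ∀ j : ℕ,
      MeasurableSet (Metric.closedBall 0 R ∩ {x | |ℓ x| ≤ 2 * (2 ^ (j * m))⁻¹}) := fun j =>
    (Metric.isClosed_closedBall.inter
      (isClosed_le ℓ.continuous.abs continuous_const)).measurableSet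
  refine (lintegral_mono (enorm_slabSum_pow_le hχ0 hχ1 hχR hm)).trans ?_
  rw [lintegral_finsetSum _ fun j _ => measurable_const.indicator (hmeas j)]
  have hj : ∀ j ∈ Finset.range N,
      ∫⁻ x, (Metric.closedBall 0 R ∩ {x | |ℓ x| ≤ 2 * (2 ^ (j * m))⁻¹}).indicator
        (fun _ => (2 : ℝ≥0∞) ^ m * 2 ^ (j * m)) x ∂μ ≤ 2 ^ m * C * 2 := by
    intro j _
    rw [lintegral_indicator_const (hmeas j)]
    have h2 : ENNReal.ofReal (2 * (2 ^ (j * m))⁻¹) = 2 * (2 ^ (j * m))⁻¹ := by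
      rw [ENNReal.ofReal_mul (by norm_num), ENNReal.ofReal_inv_of_pos (by positivity),
        ENNReal.ofReal_pow (by norm_num)]
      simp
    calc _ ≤ (2 : ℝ≥0∞) ^ m * 2 ^ (j * m) * (C * (2 * (2 ^ (j * m))⁻¹)) := by
          gcongr
          exact (hle _ (by positivity)).trans_eq (by rw [h2])
      _ = 2 ^ m * C * 2 * (2 ^ (j * m) * (2 ^ (j * m))⁻¹) := by ring
      _ = 2 ^ m * C * 2 := by
        rw [ENNReal.mul_inv_cancel (by positivity) (by finiteness), mul_one]
  calc _ ≤ ∑ _j ∈ Finset.range N, 2 ^ m * C * 2 := Finset.sum_le_sum hj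
    _ = _ := by
      rw [Finset.sum_const, Finset.card_range, nsmul_eq_mul, mul_comm]

/-- For `p ≤ m` the `L^p` norm of `slabSum` is `O(N^{1/m})` as well, by Hölder's inequality on a
ball. -/
theorem exists_eLpNorm_slabSum_le [FiniteDimensional ℝ E] [MeasurableSpace E] [BorelSpace E]
    (μ : Measure E) [μ.IsAddHaarMeasure] (hℓ : ℓ ≠ 0) {R : ℝ} (hχ : ContDiff ℝ ∞ χ)
    (hχ0 : ∀ x, 0 ≤ χ x)
    (hχ1 : ∀ x, χ x ≤ 1) (hχR : ∀ x, x ∉ Metric.closedBall 0 R → χ x = 0) (hm : m ≠ 0)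
    {p : ℝ} (hp : 0 < p) (hpm : p ≤ m) :
    ∃ C : ℝ≥0∞, C ≠ ⊤ ∧ ∀ N,
      eLpNorm (slabSum ℓ χ m N) (ENNReal.ofReal p) μ ≤ C * (N : ℝ≥0∞) ^ (1 / m : ℝ) := by
  obtain ⟨C, hC, hle⟩ := exists_lintegral_slabSum_le μ hℓ hχ0 hχ1 hχR hm
  have hm0 : (0 : ℝ) < m := by positivity
  have hp1 : 0 ≤ 1 / p - 1 / m := sub_nonneg.2 (one_div_le_one_div_of_le hp hpm)
  refine ⟨C ^ (1 / m : ℝ) * μ (Metric.closedBall 0 R) ^ (1 / p - 1 / m : ℝ),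
    ENNReal.mul_ne_top (ENNReal.rpow_ne_top_of_nonneg (by positivity) hC)
      (ENNReal.rpow_ne_top_of_nonneg hp1 measure_closedBall_lt_top.ne), fun N => ?_⟩
  have hsupp : Function.support (slabSum ℓ χ m N) ⊆ Metric.closedBall 0 R := by
    intro x hx
    by_contra h
    exact hx (by simp [slabSum, hχR x h])
  have hpm' : ENNReal.ofReal p ≤ (m : ℝ≥0∞) := by
    rw [← ENNReal.ofReal_natCast]
    exact ENNReal.ofReal_le_ofReal hpm
  have hmeas : AEStronglyMeasurable (slabSum ℓ χ m N) (μ.restrict (Metric.closedBall 0 R)) :=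
    (contDiff_slabSum hχ).continuous.aestronglyMeasurable
  have h1 := eLpNorm_le_eLpNorm_mul_rpow_measure_univ hpm' hmeas
  rw [eLpNorm_restrict_eq_of_support_subset hsupp, eLpNorm_restrict_eq_of_support_subset hsupp,
    Measure.restrict_apply_univ, ENNReal.toReal_ofReal hp.le, ENNReal.toReal_natCast] at h1
  have h2 : eLpNorm (slabSum ℓ χ m N) m μ ≤ (C * N) ^ (1 / m : ℝ) := by
    rw [eLpNorm_eq_lintegral_rpow_enorm_toReal (by exact_mod_cast hm)
      (ENNReal.natCast_ne_top m), ENNReal.toReal_natCast]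
    simp only [ENNReal.rpow_natCast]
    gcongr
    exact hle N
  calc _ ≤ _ := h1
    _ ≤ (C * N) ^ (1 / m : ℝ) * μ (Metric.closedBall 0 R) ^ (1 / p - 1 / m : ℝ) := by gcongr
    _ = _ := by
      rw [ENNReal.mul_rpow_of_nonneg _ _ (by positivity)]
      ring

end slabSum

/-! ### Unboundedness of the maximal operator -/

/-- `A N ≤ B N^{1/m}` cannot hold for all `N` when `m ≥ 2`. -/
theorem eq_zero_of_forall_mul_le_mul_rpow {A B : ℝ≥0∞} {m : ℕ} (hm : 2 ≤ m) (hB : B ≠ ⊤)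
    (h : ∀ N : ℕ, A * N ≤ B * (N : ℝ≥0∞) ^ (1 / m : ℝ)) : A = 0 := by
  by_contra hA
  obtain ⟨N, hN⟩ := ENNReal.exists_nat_mul_gt (pow_ne_zero m hA) (ENNReal.pow_ne_top hB (n := m))
  have hN0 : N ≠ 0 := by
    rintro rfl
    simp at hN
  have hm0 : (m : ℝ) ≠ 0 := by
    have : m ≠ 0 := by omega
    exact_mod_cast this
  have h1 : A ^ m * N ^ m ≤ B ^ m * N := by
    have := pow_le_pow_left₀ zero_le (h N) m
    rwa [mul_pow, mul_pow, ← ENNReal.rpow_natCast ((N : ℝ≥0∞) ^ (1 / m : ℝ)), ← ENNReal.rpow_mul,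
      one_div, inv_mul_cancel₀ hm0, ENNReal.rpow_one] at this
  have h2 : (N : ℝ≥0∞) * N ≤ N ^ m := by
    rw [← sq]
    exact_mod_cast Nat.pow_le_pow_right (Nat.pos_of_ne_zero hN0) hm
  have h3 : (N * A ^ m) * N ≤ B ^ m * N := by
    calc (N * A ^ m) * N = A ^ m * (N * N) := by ring
      _ ≤ A ^ m * N ^ m := by gcongr
      _ ≤ _ := h1
  rw [ENNReal.mul_le_mul_iff_left (by exact_mod_cast hN0) (ENNReal.natCast_ne_top N)] at h3
  exact absurd h3 (not_le.2 hN)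

section maximal

variable {E : Type*} [NormedAddCommGroup E] [NormedSpace ℝ E] [MeasurableSpace E] [BorelSpace E]

/-- The averages of `slabSum` over dilates of a surface, at a dilation `t` matched to `x` so that
the hyperplane `ℓ = c` is carried to `ℓ = 0`, are at least a multiple of `N`: each of the `N`
scales contributes a fixed amount. -/
theorem ofReal_mul_le_enorm_integral_slabSum {ν : Measure E} {ℓ : E →L[ℝ] ℝ} {χ φ : E → ℝ}
    {m N : ℕ} {c c₀ φ₀ R t : ℝ} {x : E} (hφ : Continuous φ) (hφc : HasCompactSupport φ)
    (hφ0 : 0 ≤ᵐ[ν] φ) (hν : ν (tsupport φ) < ⊤) (hφ₀ : 0 < φ₀)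
    (hφR : ∀ s, φ s ≠ 0 → ‖x - t • s‖ ≤ R)
    (hG : ∀ j : ℕ, ENNReal.ofReal (c₀ * (2 ^ j)⁻¹)
      ≤ ν {q | φ₀ ≤ φ q ∧ |ℓ q - c| ≤ (2 ^ (j * m))⁻¹ / 2})
    (hχ : Continuous χ) (hχ0 : ∀ x, 0 ≤ χ x) (hχ1 : ∀ x, ‖x‖ ≤ R → χ x = 1)
    (ht0 : 0 < t) (ht2 : t < 2) (hxt : ℓ x = t * c) (hc₀ : 0 < c₀) :
    ENNReal.ofReal (φ₀ * c₀) * N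
      ≤ ‖∫ s, φ s • ((slabSum ℓ χ m N (x - t • s) : ℝ) : ℂ) ∂ν‖ₑ := by
  have hcont : Continuous fun s => φ s * slabSum ℓ χ m N (x - t • s) := by
    refine hφ.mul ?_
    unfold slabSum
    have hb : Continuous unitBump := unitBump.continuous
    fun_prop
  have hcs : HasCompactSupport fun s => φ s * slabSum ℓ χ m N (x - t • s) := hφc.mul_right
  have hint : Integrable (fun s => φ s * slabSum ℓ χ m N (x - t • s)) ν := by
    obtain ⟨B, hB⟩ := hcs.exists_bound_of_continuous hcont
    refine IntegrableOn.integrable_of_forall_notMem_eq_zero (s := tsupport φ) ?_ fun s hs => by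
      simp [image_eq_zero_of_notMem_tsupport hs]
    exact Measure.integrableOn_of_bounded hν.ne hcont.aestronglyMeasurable
      (ae_of_all _ hB)
  have hnn : 0 ≤ᵐ[ν] fun s => φ s * slabSum ℓ χ m N (x - t • s) := by
    filter_upwards [hφ0] with s hs
    exact mul_nonneg hs (slabSum_nonneg hχ0 _)
  have hre : ∫ s, φ s • ((slabSum ℓ χ m N (x - t • s) : ℝ) : ℂ) ∂ν
      = ((∫ s, φ s * slabSum ℓ χ m N (x - t • s) ∂ν : ℝ) : ℂ) := by
    rw [← integral_complex_ofReal]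
    congr 1
    ext s
    simp
  set G : ℕ → Set E := fun j => {q | φ₀ ≤ φ q ∧ |ℓ q - c| ≤ (2 ^ (j * m))⁻¹ / 2} with hGdef
  have hGm : ∀ j, MeasurableSet (G j) := fun j =>
    ((isClosed_le continuous_const hφ).inter
      (isClosed_le (ℓ.continuous.sub continuous_const).abs continuous_const)).measurableSet
  have henorm : ∀ r : ℝ, ‖(r : ℂ)‖ₑ = ‖r‖ₑ := fun r =>
    enorm_eq_iff_norm_eq.2 (Complex.norm_real r)
  rw [hre, henorm, Real.enorm_of_nonneg (integral_nonneg_of_ae hnn),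
    ofReal_integral_eq_lintegral_ofReal hint hnn]
  have hpt : ∀ᵐ s ∂ν, ∑ j ∈ Finset.range N, (G j).indicator
      (fun _ => ENNReal.ofReal (φ₀ * 2 ^ j)) s
      ≤ ENNReal.ofReal (φ s * slabSum ℓ χ m N (x - t • s)) := by
    filter_upwards [hφ0] with s hs
    by_cases hs0 : φ s < φ₀
    · have : ∀ j, s ∉ G j := fun j hj => absurd hj.1 (not_le.2 hs0)
      simp [this]
    rw [not_lt] at hs0
    rw [slabSum, hχ1 _ (hφR s (hφ₀.trans_le hs0).ne'), one_mul, Finset.mul_sum,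
      ENNReal.ofReal_sum_of_nonneg fun j _ =>
        mul_nonneg hs (mul_nonneg (by positivity) unitBump.nonneg)]
    refine Finset.sum_le_sum fun j _ => ?_
    by_cases hsG : s ∈ G j
    swap
    · simp [hsG]
    rw [Set.indicator_of_mem hsG]
    have hbump : unitBump (2 ^ (j * m) * ℓ (x - t • s)) = 1 := by
      refine unitBump.one_of_mem_closedBall ?_
      have hval : ℓ (x - t • s) = -(t * (ℓ s - c)) := by
        rw [map_sub, map_smul, smul_eq_mul, hxt]
        ring
      have hle : t * |ℓ s - c| ≤ 2 * ((2 ^ (j * m))⁻¹ / 2) :=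
        mul_le_mul ht2.le hsG.2 (abs_nonneg _) (by norm_num)
      rw [mem_closedBall_zero_iff, Real.norm_eq_abs, hval, abs_mul, abs_neg, abs_mul,
        abs_of_pos ht0, abs_of_pos (by positivity : (0 : ℝ) < 2 ^ (j * m))]
      calc (2 : ℝ) ^ (j * m) * (t * |ℓ s - c|)
          ≤ 2 ^ (j * m) * (2 * ((2 ^ (j * m))⁻¹ / 2)) := by gcongr
        _ = 1 := by field_simp
    rw [hbump, mul_one]
    gcongr
  refine le_trans ?_ (lintegral_mono_ae hpt)
  rw [lintegral_finsetSum _ fun j _ => measurable_const.indicator (hGm j)]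
  have hj : ∀ j ∈ Finset.range N, ENNReal.ofReal (φ₀ * c₀)
      ≤ ∫⁻ s, (G j).indicator (fun _ => ENNReal.ofReal (φ₀ * 2 ^ j)) s ∂ν := by
    intro j _
    rw [lintegral_indicator_const (hGm j)]
    calc ENNReal.ofReal (φ₀ * c₀)
        = ENNReal.ofReal (φ₀ * 2 ^ j) * ENNReal.ofReal (c₀ * (2 ^ j)⁻¹) := by
          rw [← ENNReal.ofReal_mul (by positivity)]
          congr 1
          field_simp
      _ ≤ _ := by
        gcongr
        exact hG j
  calc ENNReal.ofReal (φ₀ * c₀) * N = ∑ _j ∈ Finset.range N, ENNReal.ofReal (φ₀ * c₀) := by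
        rw [Finset.sum_const, Finset.card_range, nsmul_eq_mul, mul_comm]
    _ ≤ _ := Finset.sum_le_sum hj

/-- If `ν` charges the region within `2^{-jm}` of the hyperplane `ℓ = c`, which misses the origin,
with mass at least a multiple of `2^{-j}`, then the maximal operator of `φ dν` is unbounded on `L^p`
for `p ≤ m`. -/
theorem not_forall_eLpNorm_iSup_le {E : Type*} [NormedAddCommGroup E] [InnerProductSpace ℝ E]
    [FiniteDimensional ℝ E] [MeasurableSpace E] [BorelSpace E] (μ : Measure E)
    [μ.IsAddHaarMeasure] {ν : Measure E} {ℓ : E →L[ℝ] ℝ} {φ : E → ℝ} {m : ℕ} {c₀ φ₀ : ℝ} {y : E}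
    (hy : ℓ y ≠ 0) (hφ : Continuous φ) (hφc : HasCompactSupport φ) (hφ0 : 0 ≤ᵐ[ν] φ)
    (hν : ν (tsupport φ) < ⊤) (hφ₀ : 0 < φ₀) (hc₀ : 0 < c₀)
    (hG : ∀ j : ℕ, ENNReal.ofReal (c₀ * (2 ^ j)⁻¹)
      ≤ ν {q | φ₀ ≤ φ q ∧ |ℓ q - ℓ y| ≤ (2 ^ (j * m))⁻¹ / 2})
    (hm : 2 ≤ m) {p : ℝ} (hp : 0 < p) (hpm : p ≤ m) :
    ¬ ∃ C : ℝ≥0, ∀ f : 𝓢(E, ℂ),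
      eLpNorm (fun x => ⨆ (t : ℝ) (_ : 0 < t), ‖∫ s, φ s • f (x - t • s) ∂ν‖ₑ)
        (ENNReal.ofReal p) μ ≤ C * eLpNorm f (ENNReal.ofReal p) μ := by
  rintro ⟨C, hC⟩
  have hℓ : ℓ ≠ 0 := by
    rintro rfl
    simp at hy
  obtain ⟨Rφ, hRφ0, hRφ⟩ : ∃ R > 0, ∀ s, φ s ≠ 0 → ‖s‖ ≤ R := by
    obtain ⟨R, hR0, hR⟩ := hφc.isCompact.isBounded.subset_closedBall_lt 0 0
    exact ⟨R, hR0, fun s hs => by simpa using hR (subset_tsupport _ hs)⟩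
  -- the points `x` whose matched dilation `ℓ x / ℓ y` lies in `(1, 2)`
  set X : Set E := {x | ‖x‖ < 2 * ‖y‖ ∧ 1 < ℓ x / ℓ y ∧ ℓ x / ℓ y < 2} with hX
  have hXo : IsOpen X := (isOpen_lt continuous_norm continuous_const).inter
    ((isOpen_lt continuous_const (ℓ.continuous.div_const _)).inter
      (isOpen_lt (ℓ.continuous.div_const _) continuous_const))
  have hy0 : 0 < ‖y‖ := norm_pos_iff.2 (by rintro rfl; simp at hy)
  have hXne : X.Nonempty := by
    refine ⟨(3 / 2 : ℝ) • y, ?_, ?_⟩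
    · rw [norm_smul, Real.norm_of_nonneg (by norm_num)]
      linarith
    · rw [map_smul, smul_eq_mul, mul_div_assoc, div_self hy]
      norm_num
  have hXpos : μ X ≠ 0 := (hXo.measure_pos μ hXne).ne'
  have hXtop : μ X ≠ ⊤ := by
    refine (lt_of_le_of_lt (measure_mono fun x hx => ?_)
      (measure_closedBall_lt_top (μ := μ) (x := 0) (r := 2 * ‖y‖))).ne
    simpa using hx.1.le
  set R := 2 * ‖y‖ + 2 * Rφ with hR
  have hR0 : 0 < R := by positivity
  let χ : ContDiffBump (0 : E) := ⟨R, R + 1, hR0, by linarith⟩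
  have hχR : ∀ x, x ∉ Metric.closedBall (0 : E) (R + 1) → χ x = 0 := fun x hx =>
    χ.zero_of_le_dist (not_le.1 hx).le
  have hχ1 : ∀ x : E, ‖x‖ ≤ R → χ x = 1 := fun x hx =>
    χ.one_of_mem_closedBall (mem_closedBall_zero_iff.2 hx)
  obtain ⟨B, hB, hBle⟩ := exists_eLpNorm_slabSum_le μ hℓ χ.contDiff (fun _ => χ.nonneg)
    (fun _ => χ.le_one) hχR (by omega : m ≠ 0) hp hpm
  have hzero : ENNReal.ofReal (φ₀ * c₀) * μ X ^ (1 / p) = 0 := by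
    refine eq_zero_of_forall_mul_le_mul_rpow hm (ENNReal.mul_ne_top ENNReal.coe_ne_top hB :
      C * B ≠ ⊤) fun N => ?_
    have hcs : HasCompactSupport fun x => ((slabSum ℓ χ m N x : ℝ) : ℂ) :=
      (hasCompactSupport_slabSum χ.hasCompactSupport).comp_left Complex.ofReal_zero
    have hcd : ContDiff ℝ ∞ fun x => ((slabSum ℓ χ m N x : ℝ) : ℂ) :=
      Complex.ofRealCLM.contDiff.comp (contDiff_slabSum χ.contDiff)
    have hlow : ∀ x, X.indicator (fun _ => ENNReal.ofReal (φ₀ * c₀) * N) x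
        ≤ ⨆ (t : ℝ) (_ : 0 < t),
          ‖∫ s, φ s • (hcs.toSchwartzMap hcd) (x - t • s) ∂ν‖ₑ := by
      intro x
      by_cases hx : x ∈ X
      swap
      · simp [hx]
      obtain ⟨hx1, hx2, hx3⟩ := hx
      rw [Set.indicator_of_mem (show x ∈ X from ⟨hx1, hx2, hx3⟩)]
      refine le_iSup₂_of_le (ℓ x / ℓ y) (by linarith) ?_
      refine ofReal_mul_le_enorm_integral_slabSum hφ hφc hφ0 hν hφ₀ (R := R) (fun s hs => ?_) hG
        χ.continuous (fun _ => χ.nonneg) hχ1 (by linarith) hx3 (div_mul_cancel₀ _ hy).symm hc₀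
      refine (norm_sub_le _ _).trans (add_le_add hx1.le ?_)
      rw [norm_smul, Real.norm_of_nonneg (by linarith)]
      exact mul_le_mul hx3.le (hRφ s hs) (norm_nonneg _) (by norm_num)
    have hp0 : ENNReal.ofReal p ≠ 0 := (ENNReal.ofReal_pos.2 hp).ne'
    calc ENNReal.ofReal (φ₀ * c₀) * μ X ^ (1 / p) * N
        = ENNReal.ofReal (φ₀ * c₀) * N * μ X ^ (1 / p) := by ring
      _ = eLpNorm (X.indicator fun _ => ENNReal.ofReal (φ₀ * c₀) * N) (ENNReal.ofReal p) μ := by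
        rw [eLpNorm_indicator_const hXo.measurableSet hp0 ENNReal.ofReal_ne_top,
          ENNReal.toReal_ofReal hp.le, enorm_eq_self]
      _ ≤ _ := eLpNorm_mono_enorm fun x => by simpa only [enorm_eq_self] using hlow x
      _ ≤ C * eLpNorm (hcs.toSchwartzMap hcd) (ENNReal.ofReal p) μ := hC _
      _ = C * eLpNorm (slabSum ℓ χ m N) (ENNReal.ofReal p) μ := by
        congr 1
        exact eLpNorm_congr_norm_ae (ae_of_all _ fun x => Complex.norm_real _)
      _ ≤ C * (B * (N : ℝ≥0∞) ^ (1 / m : ℝ)) := by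
        gcongr
        exact hBle N
      _ = C * B * (N : ℝ≥0∞) ^ (1 / m : ℝ) := (mul_assoc _ _ _).symm
  rcases mul_eq_zero.1 hzero with h | h
  · exact (ENNReal.ofReal_pos.2 (mul_pos hφ₀ hc₀)).ne' h
  · rw [ENNReal.rpow_eq_zero_iff_of_pos (by positivity)] at h
    exact hXpos h

end maximal

/-! ### The surface measure near the tangent hyperplane -/

/-- The functional `q ↦ q_{n+1} - ∇g(z)·(q₁, …, qₙ)`, whose level set through `(z, g(z))` is the
affine tangent hyperplane there. -/
noncomputable def tangentFunctional {n : ℕ} (g : EuclideanSpace ℝ (Fin n) → ℝ)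
    (z : EuclideanSpace ℝ (Fin n)) : EuclideanSpace ℝ (Fin (n + 1)) →L[ℝ] ℝ :=
  LinearMap.toContinuousLinearMap
    { toFun := fun q => q (Fin.last n) - fderiv ℝ g z (proj q)
      map_add' := fun p q => by
        have : proj (p + q) = proj p + proj q := rfl
        rw [this, map_add, PiLp.add_apply]
        ring
      map_smul' := fun r q => by
        have : proj (r • q) = r • proj q := rfl
        rw [this, map_smul, PiLp.smul_apply]
        simp only [smul_eq_mul, RingHom.id_apply]
        ring }

theorem tangentFunctional_apply {n : ℕ} (g : EuclideanSpace ℝ (Fin n) → ℝ)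
    (z : EuclideanSpace ℝ (Fin n)) (q : EuclideanSpace ℝ (Fin (n + 1))) :
    tangentFunctional g z q = q (Fin.last n) - fderiv ℝ g z (proj q) := rfl

theorem tangentFunctional_graphPoint_sub {n : ℕ} (g : EuclideanSpace ℝ (Fin n) → ℝ)
    (z x : EuclideanSpace ℝ (Fin n)) :
    tangentFunctional g z (graphPoint g (x + z)) - tangentFunctional g z (graphPoint g z)
      = heightFn g z x := by
  simp only [tangentFunctional_apply, graphPoint_last, proj_graphPoint, heightFn, map_add]
  ring

/-- Where `H` is `O((xᵢ - b)^m)`, the part of `S` on which `|H| ≤ 2^{-jm} / 2` has measure at least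
a multiple of `2^{-j}`. -/
theorem exists_le_restrict_near_tangent {n : ℕ} {S U : Set (EuclideanSpace ℝ (Fin (n + 1)))}
    {g : EuclideanSpace ℝ (Fin n) → ℝ} {z a : EuclideanSpace ℝ (Fin n)}
    {φ : EuclideanSpace ℝ (Fin (n + 1)) → ℝ} {m : ℕ} {φ₀ : ℝ} (hm : m ≠ 0)
    (hS : IsGraphOn S U g) (hφ : Continuous φ) (hUa : ∀ᶠ x in 𝓝 a, graphPoint g (x + z) ∈ U)
    (hφa : ∀ᶠ x in 𝓝 a, φ₀ ≤ φ (graphPoint g (x + z)))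
    {i : Fin n} {ξ : EuclideanSpace ℝ (Fin n) → ℝ}
    {b : EuclideanSpace ℝ {j : Fin n // j ≠ i} → ℝ} (hξ : ContinuousAt ξ a)
    (hb : ContinuousAt b (WithLp.toLp 2 fun j => a j))
    (hba : b (WithLp.toLp 2 fun j => a j) = a i)
    (hH : ∀ᶠ x in 𝓝 a, heightFn g z x = ξ x * (x i - b (WithLp.toLp 2 fun j => x j)) ^ m) :
    ∃ c₀ > 0, ∀ j : ℕ, ENNReal.ofReal (c₀ * (2 ^ j)⁻¹)
      ≤ (μHE[n] : Measure (EuclideanSpace ℝ (Fin (n + 1)))).restrict S {q | φ₀ ≤ φ q ∧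
        |tangentFunctional g z q - tangentFunctional g z (graphPoint g z)|
          ≤ (2 ^ (j * m))⁻¹ / 2} := by
  set M := |ξ a| + 1 with hM
  have hM1 : 1 ≤ M := by
    have := abs_nonneg (ξ a)
    linarith
  have hξM : ∀ᶠ x in 𝓝 a, |ξ x| ≤ M :=
    (hξ.abs.eventually (gt_mem_nhds (show |ξ a| < M by linarith))).mono fun _ h => le_of_lt h
  obtain ⟨c, hc, ε₀, hε₀, hle⟩ :=
    exists_le_volume_near_graph hb hba (hUa.and (hφa.and (hξM.and hH)))
  -- `κ` is small enough that `M κ^m ≤ 1/2`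
  set κ := min ε₀ (1 / (2 * M)) with hκ
  have hκ0 : 0 < κ := lt_min hε₀ (by positivity)
  have hκM : M * κ ^ m ≤ 1 / 2 := by
    have h1 : κ ≤ 1 / (2 * M) := min_le_right _ _
    have h2 : κ ≤ 1 := h1.trans (by rw [div_le_one (by positivity)]; linarith)
    calc M * κ ^ m ≤ M * κ := by
          gcongr
          exact pow_le_of_le_one hκ0.le h2 hm
      _ ≤ M * (1 / (2 * M)) := by gcongr
      _ = 1 / 2 := by field_simp
  refine ⟨c * κ, by positivity, fun j => ?_⟩
  have h2j : ((2 : ℝ) ^ j)⁻¹ ≤ 1 := inv_le_one_of_one_le₀ (one_le_pow₀ one_le_two)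
  have hε1 : κ * (2 ^ j)⁻¹ ≤ ε₀ :=
    (mul_le_of_le_one_right hκ0.le h2j).trans (min_le_left _ _)
  rw [mul_assoc]
  refine (hle (κ * (2 ^ j)⁻¹) (by positivity) hε1).trans ?_
  set D := {x | graphPoint g (x + z) ∈ U ∧ φ₀ ≤ φ (graphPoint g (x + z)) ∧ |ξ x| ≤ M ∧
      heightFn g z x = ξ x * (x i - b (WithLp.toLp 2 fun j => x j)) ^ m} ∩
    {x | |x i - b (WithLp.toLp 2 fun j => x j)| ≤ κ * (2 ^ j)⁻¹} with hD
  have hmeas : MeasurableSet {q | φ₀ ≤ φ q ∧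
      |tangentFunctional g z q - tangentFunctional g z (graphPoint g z)|
        ≤ (2 ^ (j * m))⁻¹ / 2} :=
    ((isClosed_le continuous_const hφ).inter (isClosed_le
      ((tangentFunctional g z).continuous.sub continuous_const).abs
        continuous_const)).measurableSet
  rw [Measure.restrict_apply hmeas]
  calc volume D = volume ((fun x => x + (-z)) ⁻¹' D) := (measure_preimage_add_right _ _ _).symm
    _ ≤ μHE[n] (graphPoint g '' ((fun x => x + (-z)) ⁻¹' D)) :=
      volume_le_euclideanHausdorffMeasure_graphPoint g _
    _ ≤ _ := by
      refine measure_mono ?_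
      rintro _ ⟨x, hx, rfl⟩
      obtain ⟨⟨hxU, hxφ, hxM, hxH⟩, hxb⟩ := hx
      have hxz : x + (-z) + z = x := by abel
      rw [hxz] at hxU hxφ
      refine ⟨⟨hxφ, ?_⟩, (hS _ hxU).2 ?_⟩
      · have := tangentFunctional_graphPoint_sub g z (x + (-z))
        rw [hxz] at this
        rw [this, hxH, abs_mul, abs_pow]
        calc _ ≤ M * (κ * (2 ^ j)⁻¹) ^ m := by gcongr; exact hxb
          _ = M * κ ^ m * (2 ^ (j * m))⁻¹ := by rw [mul_pow, inv_pow, ← pow_mul]; ring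
          _ ≤ 1 / 2 * (2 ^ (j * m))⁻¹ := by gcongr
          _ = (2 ^ (j * m))⁻¹ / 2 := by ring
      · rw [graphPoint_last, proj_graphPoint]

end NewtonMaximal

theorem theorem1p2 (n : ℕ) (hn : 2 ≤ n)
    (S U : Set (EuclideanSpace ℝ (Fin (n + 1))))
    (g : EuclideanSpace ℝ (Fin n) → ℝ) (z : EuclideanSpace ℝ (Fin n))
    (φ : EuclideanSpace ℝ (Fin (n + 1)) → ℝ) (m : ℕ)
    -- near `y = (z, g(z))` the hypersurface `S` is the graph of the real-analytic function `g`
    (hU : IsOpen U) (hyU : NewtonMaximal.graphPoint g z ∈ U)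
    (hS : NewtonMaximal.IsGraphOn S U g)
    (hg : AnalyticOnNhd ℝ g (NewtonMaximal.proj '' U))
    (hT : NewtonMaximal.graphPoint g z ∉ NewtonMaximal.tangentSpace g z)
    -- the smooth cutoff function
    (hφ : ContDiff ℝ ∞ φ) (hφc : HasCompactSupport φ) (hφU : tsupport φ ⊆ U)
    (hφ0 : ∀ s ∈ S, 0 ≤ φ s) (hφy : φ (NewtonMaximal.graphPoint g z) ≠ 0)
    -- the maximal order of a zero of a face polynomial
    (hm : IsGreatest (NewtonMaximal.faceZeroOrders (NewtonMaximal.heightFn g z)) m)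
    (hmd : max (NewtonMaximal.newtonDistance (NewtonMaximal.heightFn g z)) 2 < (m : ℝ))
    -- the points `a^k` and the form of `H` near them
    (a : ℕ → EuclideanSpace ℝ (Fin n)) (ha0 : ∀ k i, a k i ≠ 0) (ha : Tendsto a atTop (𝓝 0))
    (hH : ∀ k, ∃ (i : Fin n) (ξ : EuclideanSpace ℝ (Fin n) → ℝ)
      (b : EuclideanSpace ℝ {j : Fin n // j ≠ i} → ℝ),
      AnalyticAt ℝ ξ (a k) ∧ ξ (a k) ≠ 0 ∧
      AnalyticAt ℝ b (WithLp.toLp 2 fun j => a k j) ∧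
      b (WithLp.toLp 2 fun j => a k j) = a k i ∧
      ∀ᶠ x in 𝓝 (a k), NewtonMaximal.heightFn g z x
        = ξ x * (x i - b (WithLp.toLp 2 fun j => x j)) ^ m) :
    ∀ p : ℝ, 0 < p → p ≤ m → ¬ NewtonMaximal.MaximalBoundedOnLp S φ p := by
  intro p hp hpm
  set y := NewtonMaximal.graphPoint g z with hy
  set T := NewtonMaximal.tangentFunctional g z
  have hm2 : 2 ≤ m := by
    have : (2 : ℝ) < m := (le_max_right _ _).trans_lt hmd
    exact_mod_cast this.le
  have hTy : T y ≠ 0 := fun h => hT (sub_eq_zero.1 h)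
  have hyS : y ∈ S :=
    (hS y hyU).2 (by rw [hy, NewtonMaximal.graphPoint_last, NewtonMaximal.proj_graphPoint])
  have hφpos : 0 < φ y := (hφ0 y hyS).lt_of_ne' hφy
  have hφ₂ : φ y / 2 < φ y := half_lt_self hφpos
  have hcont : ∀ x, NewtonMaximal.graphPoint g (x + z) ∈ U →
      ContinuousAt (fun w => NewtonMaximal.graphPoint g (w + z)) x := fun x hx =>
    ContinuousAt.comp (f := fun w => w + z) (NewtonMaximal.continuousAt_graphPoint
      (hg _ ⟨_, hx, NewtonMaximal.proj_graphPoint g _⟩).continuousAt) (by fun_prop)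
  have hcφ : ∀ x, NewtonMaximal.graphPoint g (x + z) ∈ U →
      ContinuousAt (fun w => φ (NewtonMaximal.graphPoint g (w + z))) x := fun x hx =>
    ContinuousAt.comp (f := fun w => NewtonMaximal.graphPoint g (w + z))
      hφ.continuous.continuousAt (hcont x hx)
  have h0 : NewtonMaximal.graphPoint g (0 + z) = y := by rw [zero_add]
  have h0U : NewtonMaximal.graphPoint g (0 + z) ∈ U := by rwa [h0]
  have hU0 : ∀ᶠ x in 𝓝 0, NewtonMaximal.graphPoint g (x + z) ∈ U :=
    (hcont 0 h0U).eventually (hU.mem_nhds h0U)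
  have hφ1 : ∀ᶠ x in 𝓝 0, φ y / 2 < φ (NewtonMaximal.graphPoint g (x + z)) :=
    (hcφ 0 h0U).eventually (lt_mem_nhds
      (show φ y / 2 < φ (NewtonMaximal.graphPoint g (0 + z)) by rwa [h0]))
  obtain ⟨k, hkU, hkφ⟩ := (ha.eventually (hU0.and hφ1)).exists
  obtain ⟨i, ξ, b, hξ, -, hb, hba, hHk⟩ := hH k
  obtain ⟨c₀, hc₀, hG⟩ := NewtonMaximal.exists_le_restrict_near_tangent (by omega : m ≠ 0) hS
    hφ.continuous ((hcont _ hkU).eventually (hU.mem_nhds hkU))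
    (((hcφ _ hkU).eventually (lt_mem_nhds hkφ)).mono fun _ h => le_of_lt h)
    hξ.continuousAt hb.continuousAt hba hHk
  have hφae : 0 ≤ᵐ[(μHE[n]).restrict S] φ := by
    have hmeas : MeasurableSet {q | 0 ≤ φ q} :=
      (isClosed_le continuous_const hφ.continuous).measurableSet
    -- `S` need not be measurable, but the set where `0 ≤ φ` is
    exact (ae_restrict_iff hmeas).2 (ae_of_all _ hφ0)
  exact NewtonMaximal.not_forall_eLpNorm_iSup_le volume hTy hφ.continuous hφc hφae
    (NewtonMaximal.euclideanHausdorffMeasure_restrict_lt_top hU hS hg hφc.isCompact hφU)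
    (half_pos hφpos) hc₀ hG hm2 hp hpm
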